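/- Let $E\subset\mathbb{R}^{n+1}$ be a non-empty bounded set satisfying the uniform ball condition with some radius $r>0$: for every $x\in\partial E$ there are open balls $B_r(x_+)\subset\mathbb{R}^{n+1}\setminus E$ and $B_r(x_-)\subset E$ with $x\in\partial B_r(x_+)\cap\partial B_r(x_-)$. Let $\nu_E$ be the outer unit normal on $\partial E$, let $r_E$ be the supremum of all radii for which $E$ satisfies the uniform ball condition, and let $$S_E(x,y)=\frac{(x-y)\cdot\nu_E(x)}{|x-y|^2},\qquad \|S_E\|_{L^\infty}=\sup\{|S_E(x,y)|: x,y\in\partial E,\ x\ne y\}.$$ Then $\nu_E$ exists at every point of $\partial E$, $r_E$ and $\|S_E\|_{L^\infty}$ are finite, and $r_E=\sup\{r>0: d_E \text{ is differentiable in } \{z:\operatorname{dist}(z,\partial E)<r\}\}$, where $d_E$ is the signed distance function of $E$ (equal to $\operatorname{dist}(x,E)$ for $x\notin E$ and to $-\operatorname{dist}(x,\mathbb{R}^{n+1}\setminus E)$ for $x\in E$). Moreover $$2\|S_E\|_{L^\infty}=\frac1{r_E}\qquad\text{and}\qquad \frac{|\nu_E(x)-\nu_E(y)|}{|x-y|}\le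 2\|S_E\|_{L^\infty}\quad\text{for all } x,y\in\partial E,\ x\neq y.$$ If in addition $E$ is $C^2$-regular (near every boundary point, in suitable orthonormal coordinates, the interior of $E$ is the strict subgraph of a $C^2$ function), then $\nu_E$ is differentiable along $\partial E$ and the second fundamental form $B_E=\nabla_\tau\nu_E$ (the tangential differential of $\nu_E$, extended by zero in the normal direction) and the mean curvature $H_E=\operatorname{Tr}B_E$ satisfy $$|H_E|\le 2n\|S_E\|_{L^\infty}\quad\text{and}\quad |B_E|\le 2n\|S_E\|_{L^\infty}\qquad\text{on }\partial E,$$ where $|B_E|=\sqrt{\operatorname{Tr}(B_E^{T}B_E)}$ is the Frobenius norm. -/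

import Mathlib

noncomputable section

namespace BallCond

/-- The Euclidean space of dimension `n + 1`. -/
abbrev Space (n : ℕ) : Type := EuclideanSpace ℝ (Fin (n + 1))

/-- Uniform ball condition with radius `r`: every boundary point of `E` lies on the boundary of an
open ball of radius `r` outside `E` and of an open ball of radius `r` inside `E`. -/
def UniformBall {n : ℕ} (E : Set (Space n)) (r : ℝ) : Prop :=
  0 < r ∧ ∀ x ∈ frontier E, ∃ p q : Space n,
    Metric.ball p r ⊆ Eᶜ ∧ Metric.ball q r ⊆ E ∧ x ∈ Metric.sphere p r ∧ x ∈ Metric.sphere q r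

/-- The supremum `r_E` of the radii of the uniform ball condition. -/
def maxRadius {n : ℕ} (E : Set (Space n)) : ℝ :=
  sSup {r : ℝ | UniformBall E r}

open Classical in
/-- The signed distance function of `E`: positive outside `E`, negative inside. -/
def signedDist {n : ℕ} (E : Set (Space n)) (x : Space n) : ℝ :=
  if x ∈ E then -Metric.infDist x Eᶜ else Metric.infDist x E

/-- The radii `r > 0` such that the signed distance function is differentiable in the open
`r`-neighbourhood of the boundary. -/
def diffRadii {n : ℕ} (E : Set (Space n)) : Set ℝ :=
  {r : ℝ | 0 < r ∧ DifferentiableOn ℝ (signedDist E) (Metric.thickening r (frontier E))}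

/-- `ν` is an outer unit normal of `E` at `x`: it has length one, and close to `x` the complement
of `E` contains every cone `{y | ⟪y - x, ν⟫ > ε |y - x|}` and `E` contains every opposite cone.
Such a vector is unique; where the boundary is locally the graph of a differentiable function it is
the usual outer unit normal. -/
def IsOuterUnitNormal {n : ℕ} (E : Set (Space n)) (x ν : Space n) : Prop :=
  ‖ν‖ = 1 ∧ ∀ ε > (0 : ℝ), ∃ δ > (0 : ℝ), ∀ y : Space n, ‖y - x‖ < δ →
    (ε * ‖y - x‖ < inner ℝ (y - x) ν → y ∉ E) ∧
    (inner ℝ (y - x) ν < -(ε * ‖y - x‖) → y ∈ E)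

open Classical in
/-- The outer unit normal field `ν_E` (zero at points which have no outer unit normal). -/
def normal {n : ℕ} (E : Set (Space n)) (x : Space n) : Space n :=
  if h : ∃ ν : Space n, IsOuterUnitNormal E x ν then h.choose else 0

/-- The two-point function `S_E (x, y) = (x - y) · ν_E(x) / |x - y| ^ 2`. -/
def twoPoint {n : ℕ} (E : Set (Space n)) (x y : Space n) : ℝ :=
  inner ℝ (x - y) (normal E x) / ‖x - y‖ ^ 2

/-- The values `|S_E (x, y)|` for distinct boundary points `x`, `y`. -/
def twoPointValues {n : ℕ} (E : Set (Space n)) : Set ℝ :=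
  {s : ℝ | ∃ x ∈ frontier E, ∃ y ∈ frontier E, x ≠ y ∧ s = |twoPoint E x y|}

/-- The supremum norm of the two-point function. -/
def twoPointNorm {n : ℕ} (E : Set (Space n)) : ℝ :=
  sSup (twoPointValues E)

/-- `E` is `C^k`-regular: around every boundary point `x`, in suitable orthonormal coordinates
centred at `x`, the interior of `E` is, in an open cylinder centred at `x`, the strict subgraph of a
`C^k` function whose graph does not leave the cylinder through its top or bottom. -/
def IsRegular {n : ℕ} (k : ℕ) (E : Set (Space n)) : Prop :=
  ∀ x ∈ frontier E, ∃ Φ : Space n ≃ₗᵢ[ℝ] WithLp 2 (EuclideanSpace ℝ (Fin n) × ℝ),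
    ∃ ρ > (0 : ℝ), ∃ R > (0 : ℝ), ∃ f : EuclideanSpace ℝ (Fin n) → ℝ,
      ContDiffOn ℝ k f (Metric.ball 0 ρ) ∧
      (∀ u ∈ Metric.ball (0 : EuclideanSpace ℝ (Fin n)) ρ, |f u| < R) ∧
      ∀ y : Space n, ‖(Φ (y - x)).fst‖ < ρ → |(Φ (y - x)).snd| < R →
        (y ∈ interior E ↔ (Φ (y - x)).snd < f (Φ (y - x)).fst)

/-- The orthogonal projection `P = I - ν_E ⊗ ν_E` onto the geometric tangent plane at `x`. -/
def tangentProj {n : ℕ} (E : Set (Space n)) (x : Space n) : Space n →L[ℝ] Space n :=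
  ContinuousLinearMap.id ℝ (Space n) - (innerSL ℝ (normal E x)).smulRight (normal E x)

/-- The second fundamental form `B_E`, the tangential differential of `ν_E` along the boundary:
a derivative of `ν_E` along the boundary composed with the projection `P`. (A derivative along the
boundary is determined on tangent vectors only; the composition with `P` does not depend on the
derivative chosen.) -/
def secondForm {n : ℕ} (E : Set (Space n)) (x : Space n) : Space n →L[ℝ] Space n :=
  (fderivWithin ℝ (normal E) (frontier E) x).comp (tangentProj E x)

/-- The mean curvature `H_E`, the trace of the second fundamental form. -/
def meanCurv {n : ℕ} (E : Set (Space n)) (x : Space n) : ℝ :=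
  LinearMap.trace ℝ (Space n) (secondForm E x : Space n →ₗ[ℝ] Space n)

/-- The Frobenius norm `√(Tr (Aᵀ A))`. -/
def frobenius {n : ℕ} (A : Space n →L[ℝ] Space n) : ℝ :=
  √(LinearMap.trace ℝ (Space n)
    (((ContinuousLinearMap.adjoint A).comp A : Space n →L[ℝ] Space n) : Space n →ₗ[ℝ] Space n))

end BallCond

end

/-! The two tangent balls of radius `r` at `x` have centres `x ± r • ν` with `ν` the normal, and `y`
lies in one of them iff `‖y - x‖ ^ 2 < ± 2 * r * ⟪y - x, ν⟫`. Boundary points avoid both balls,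
which is the bound `|S_E| ≤ 1 / (2 * r)`. Conversely such a bound keeps the boundary out of the
tangent balls of radius `r`; these are connected and meet the known smaller balls, so they stay on
the correct side. The supremum `r_E` is attained, whence `2 * ‖S_E‖ = 1 / r_E`.

The Lipschitz bound for the normal comes from the disjointness of the outer ball at one point and
the inner ball at another, by the parallelogram law.

For the distance function, tangent balls squeeze `d_E` between two functions smooth near the normal
segment, so `d_E` is differentiable within distance `r` of the boundary. In the other direction,
differentiability beyond the current radius lets the tangent balls grow
(`eq_add_of_differentiable`), so no such radius exceeds `r_E`.

In the `C^2` case the normal is locally a normalised gradient; differentiating it along curves in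
the boundary turns the Lipschitz bound into a bound on each tangential column of `B_E`. -/

noncomputable section

namespace BallCond

open Set Filter Topology Metric

/-! ### Tangent balls, the normal, and the two-point function -/

section Geometry

variable {n : ℕ} {E : Set (Space n)}

theorem subset_interior_of_disjoint_frontier {s : Set (Space n)} (hs : IsPreconnected s)
    (hd : Disjoint s (frontier E)) {a : Space n} (ha : a ∈ s) (haE : a ∈ E) :
    s ⊆ interior E := by
  have hcover : s ⊆ interior E ∪ (closure E)ᶜ := by
    intro y hy
    by_contra h
    simp only [mem_union, mem_compl_iff, not_or, not_not] at h
    exact disjoint_left.1 hd hy ⟨h.2, h.1⟩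
  refine hs.subset_left_of_subset_union isOpen_interior isClosed_closure.isOpen_compl
    (disjoint_left.2 fun y hy hy' => hy' (subset_closure (interior_subset hy))) hcover ⟨a, ha, ?_⟩
  exact (hcover ha).resolve_right fun h => h (subset_closure haE)

theorem exists_mem_segment_frontier {a b : Space n} (ha : a ∈ E) (hb : b ∉ E) :
    ∃ w ∈ segment ℝ a b, w ∈ frontier E := by
  by_contra! h
  exact hb (interior_subset (subset_interior_of_disjoint_frontier
    (convex_segment a b).isPreconnected (disjoint_left.2 h) (left_mem_segment ℝ a b) ha
    (right_mem_segment ℝ a b)))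

theorem mem_ball_add_iff {x y ν : Space n} (hν : ‖ν‖ = 1) {r : ℝ} (hr : 0 < r) :
    y ∈ ball (x + r • ν) r ↔ ‖y - x‖ ^ 2 < 2 * r * inner ℝ (y - x) ν := by
  have h : ‖y - (x + r • ν)‖ ^ 2 = ‖y - x‖ ^ 2 - 2 * (r * inner ℝ (y - x) ν) + r ^ 2 := by
    rw [← sub_sub, norm_sub_sq_real, inner_smul_right, norm_smul, hν, mul_one, Real.norm_eq_abs,
      sq_abs]
  rw [mem_ball, dist_eq_norm, ← sq_lt_sq₀ (norm_nonneg _) hr.le, h]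
  constructor <;> intro <;> linarith

theorem mem_ball_sub_iff {x y ν : Space n} (hν : ‖ν‖ = 1) {r : ℝ} (hr : 0 < r) :
    y ∈ ball (x - r • ν) r ↔ ‖y - x‖ ^ 2 < -(2 * r * inner ℝ (y - x) ν) := by
  have := mem_ball_add_iff (x := x) (y := y) (ν := -ν) (by rwa [norm_neg]) hr
  rwa [smul_neg, ← sub_eq_add_neg, inner_neg_right, mul_neg] at this

/-- A unit vector whose inner product with `v` is at least `‖v‖` is parallel to `v`. -/
theorem eq_smul_of_le_inner {u v : Space n} (hu : ‖u‖ = 1) {t : ℝ} (hv : ‖v‖ ≤ t)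
    (h : t ≤ inner ℝ v u) : v = t • u := by
  have h0 : ‖v - t • u‖ ^ 2 ≤ 0 := by
    rw [norm_sub_sq_real, inner_smul_right, norm_smul, hu, mul_one, Real.norm_eq_abs, sq_abs]
    nlinarith [norm_nonneg v]
  have h1 : ‖v - t • u‖ = 0 := by nlinarith [norm_nonneg (v - t • u)]
  exact sub_eq_zero.1 (norm_eq_zero.1 h1)

/-- For `ν ≠ ν'` the point `x + t • (ν - ν')` lies in the outer cone of `ν` and in the inner cone of
`ν'` for small `t > 0`, so it would be both outside and inside `E`. -/
theorem IsOuterUnitNormal.eq {x ν ν' : Space n} (h : IsOuterUnitNormal E x ν)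
    (h' : IsOuterUnitNormal E x ν') : ν = ν' := by
  by_contra hne
  have hc : inner ℝ ν ν' < 1 := by
    refine lt_of_le_of_ne ?_ fun h1 => hne ?_
    · simpa [h.1, h'.1] using real_inner_le_norm ν ν'
    · exact (inner_eq_one_iff_of_norm_eq_one h.1 h'.1).1 h1
  set a : ℝ := 1 - inner ℝ ν ν' with ha
  have ha0 : 0 < a := by linarith
  have hν : inner ℝ (ν - ν') ν = a := by
    rw [inner_sub_left, real_inner_self_eq_norm_sq, h.1, real_inner_comm]; simp [ha]
  have hν' : inner ℝ (ν - ν') ν' = -a := by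
    rw [inner_sub_left, real_inner_self_eq_norm_sq, h'.1]; simp [ha]
  have hle : ‖ν - ν'‖ ≤ 2 := by
    have := norm_sub_le ν ν'
    rw [h.1, h'.1] at this
    linarith
  obtain ⟨δ, hδ, H⟩ := h.2 (a / 4) (by positivity)
  obtain ⟨δ', hδ', H'⟩ := h'.2 (a / 4) (by positivity)
  obtain ⟨t, ht0, ht⟩ := exists_between (show (0 : ℝ) < min δ δ' / 2 by positivity)
  have hy : ‖x + t • (ν - ν') - x‖ ≤ t * 2 := by
    rw [add_sub_cancel_left, norm_smul, Real.norm_eq_abs, abs_of_pos ht0]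
    gcongr
  have h1 := (H (x + t • (ν - ν')) (by linarith [min_le_left δ δ'])).1
  have h2 := (H' (x + t • (ν - ν')) (by linarith [min_le_right δ δ'])).2
  have e1 : inner ℝ (x + t • (ν - ν') - x) ν = t * a := by
    rw [add_sub_cancel_left, real_inner_smul_left, hν]
  have e2 : inner ℝ (x + t • (ν - ν') - x) ν' = -(t * a) := by
    rw [add_sub_cancel_left, real_inner_smul_left, hν', mul_neg]
  have hb : a / 4 * ‖x + t • (ν - ν') - x‖ < t * a := by
    have := mul_pos ht0 ha0
    nlinarith
  exact h1 (by rwa [e1]) (h2 (by rw [e2]; linarith))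

theorem normal_eq {x ν : Space n} (h : IsOuterUnitNormal E x ν) : normal E x = ν := by
  have hex : ∃ ν, IsOuterUnitNormal E x ν := ⟨ν, h⟩
  rw [normal, dif_pos hex]
  exact hex.choose_spec.eq h

theorem isOuterUnitNormal_of_balls {x ν : Space n} (hν : ‖ν‖ = 1) {r : ℝ} (hr : 0 < r)
    (hp : ball (x + r • ν) r ⊆ Eᶜ) (hq : ball (x - r • ν) r ⊆ E) : IsOuterUnitNormal E x ν := by
  refine ⟨hν, fun ε hε => ⟨2 * r * ε, by positivity, fun y hy => ⟨fun h => ?_, fun h => ?_⟩⟩⟩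
  · refine hp ((mem_ball_add_iff hν hr).2 ?_)
    nlinarith [norm_nonneg (y - x)]
  · refine hq ((mem_ball_sub_iff hν hr).2 ?_)
    nlinarith [norm_nonneg (y - x)]

theorem two_mul_le_of_disjoint_ball {p q : Space n} {r : ℝ} (hd : Disjoint (ball p r) (ball q r)) :
    2 * r ≤ ‖p - q‖ := by
  by_contra! h
  have hp : midpoint ℝ p q ∈ ball p r := by
    rw [mem_ball, dist_midpoint_left, dist_eq_norm, Real.norm_two]; linarith
  have hq : midpoint ℝ p q ∈ ball q r := by
    rw [mem_ball, dist_midpoint_right, dist_eq_norm, Real.norm_two]; linarith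
  exact disjoint_left.1 hd hp hq

/-- The balls are disjoint, so their centres are `2 * r` apart while both are at distance `r` from
`x`; hence `x` is their midpoint. The centres are thus governed by a normal that does not depend on
`r`, which makes different radii comparable. -/
theorem uniformBall_iff {r : ℝ} : UniformBall E r ↔ 0 < r ∧ ∀ x ∈ frontier E,
    IsOuterUnitNormal E x (normal E x) ∧
      ball (x + r • normal E x) r ⊆ Eᶜ ∧ ball (x - r • normal E x) r ⊆ E := by
  constructor
  · rintro ⟨hr, H⟩
    refine ⟨hr, fun x hx => ?_⟩
    obtain ⟨p, q, hp, hq, hxp, hxq⟩ := H x hx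
    rw [mem_sphere, dist_eq_norm] at hxp hxq
    have hd : Disjoint (ball p r) (ball q r) :=
      disjoint_left.2 fun y hy hy' => hp hy (hq hy')
    have h2 := two_mul_le_of_disjoint_ball hd
    set ν : Space n := r⁻¹ • (p - x) with hνdef
    have hν : ‖ν‖ = 1 := by
      rw [hνdef, norm_smul, norm_sub_rev, hxp, norm_inv, Real.norm_eq_abs, abs_of_pos hr,
        inv_mul_cancel₀ hr.ne']
    have hpν : p = x + r • ν := by
      rw [hνdef, smul_inv_smul₀ hr.ne', add_sub_cancel]
    have hqν : q = x - r • ν := by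
      have := eq_smul_of_le_inner (u := ν) (v := x - q) hν hxq.le (by
        have e : ‖p - q‖ ^ 2 = ‖x - q + r • ν‖ ^ 2 := by rw [hpν]; congr 2; abel
        rw [norm_add_sq_real, inner_smul_right, norm_smul, hν, hxq, Real.norm_eq_abs, mul_one,
          sq_abs] at e
        nlinarith)
      rw [← this]; abel
    rw [hpν] at hp
    rw [hqν] at hq
    have hn := isOuterUnitNormal_of_balls hν hr hp hq
    rw [normal_eq hn]
    exact ⟨hn, hp, hq⟩
  · rintro ⟨hr, H⟩
    refine ⟨hr, fun x hx => ⟨_, _, (H x hx).2.1, (H x hx).2.2, ?_, ?_⟩⟩ <;>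
    simp [norm_smul, (H x hx).1.1, hr.le]

theorem UniformBall.isOuterUnitNormal {r : ℝ} (h : UniformBall E r) {x : Space n}
    (hx : x ∈ frontier E) : IsOuterUnitNormal E x (normal E x) :=
  ((uniformBall_iff.1 h).2 x hx).1

theorem UniformBall.norm_normal {r : ℝ} (h : UniformBall E r) {x : Space n}
    (hx : x ∈ frontier E) : ‖normal E x‖ = 1 :=
  (h.isOuterUnitNormal hx).1

theorem UniformBall.outer_ball {r : ℝ} (h : UniformBall E r) {x : Space n}
    (hx : x ∈ frontier E) : ball (x + r • normal E x) r ⊆ Eᶜ :=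
  ((uniformBall_iff.1 h).2 x hx).2.1

theorem UniformBall.inner_ball {r : ℝ} (h : UniformBall E r) {x : Space n}
    (hx : x ∈ frontier E) : ball (x - r • normal E x) r ⊆ E :=
  ((uniformBall_iff.1 h).2 x hx).2.2

theorem frontier_nonempty (hbdd : Bornology.IsBounded E) (hne : E.Nonempty) :
    (frontier E).Nonempty := by
  refine nonempty_frontier_iff.2 ⟨hne, ?_⟩
  rintro rfl
  exact NormedSpace.unbounded_univ ℝ (Space n) hbdd

theorem bddAbove_uniformBall (hbdd : Bornology.IsBounded E) (hne : E.Nonempty) :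
    BddAbove {r : ℝ | UniformBall E r} := by
  obtain ⟨x, hx⟩ := frontier_nonempty hbdd hne
  refine ⟨diam (closure E), fun r hr => ?_⟩
  have hq : closedBall (x - r • normal E x) r ⊆ closure E := by
    rw [← closure_ball _ hr.1.ne']
    exact closure_mono (hr.inner_ball hx)
  have h1 : x - r • normal E x ∈ closure E := hq (mem_closedBall_self hr.1.le)
  have := dist_le_diam_of_mem hbdd.closure hx.1 h1
  rwa [dist_eq_norm, sub_sub_cancel, norm_smul, hr.norm_normal hx, mul_one, Real.norm_eq_abs,
    abs_of_pos hr.1] at this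

theorem isLUB_maxRadius
    (hbdd : Bornology.IsBounded E) (hne : E.Nonempty) (hball : ∃ r : ℝ, UniformBall E r) :
    IsLUB {r : ℝ | UniformBall E r} (maxRadius E) :=
  isLUB_csSup hball (bddAbove_uniformBall hbdd hne)

/-- With the normal fixed, the balls tangent at `x` increase with the radius, and the open ball of
radius `maxRadius E` is the union of the admissible smaller ones. -/
theorem uniformBall_maxRadius
    (hbdd : Bornology.IsBounded E) (hne : E.Nonempty) (hball : ∃ r : ℝ, UniformBall E r) :
    UniformBall E (maxRadius E) := by
  have hlub := isLUB_maxRadius hbdd hne hball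
  obtain ⟨r₀, hr₀⟩ := hball
  have hR : 0 < maxRadius E := hr₀.1.trans_le (hlub.1 hr₀)
  refine uniformBall_iff.2 ⟨hR, fun x hx => ⟨hr₀.isOuterUnitNormal hx, ?_⟩⟩
  have hν := hr₀.norm_normal hx
  have key : ∀ a b : ℝ, 0 ≤ a → a < 2 * maxRadius E * b →
      ∃ r, UniformBall E r ∧ a < 2 * r * b := by
    intro a b ha hab
    have hb : 0 < b := by
      by_contra! h
      nlinarith
    obtain ⟨r, hr, hr1, -⟩ := hlub.exists_between
      (show a / (2 * b) < maxRadius E by rw [div_lt_iff₀ (by positivity)]; linarith)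
    refine ⟨r, hr, ?_⟩
    rw [div_lt_iff₀ (by positivity)] at hr1
    linarith
  constructor
  · intro y hy
    rw [mem_ball_add_iff hν hR] at hy
    obtain ⟨r, hr, h⟩ := key _ _ (by positivity) hy
    exact hr.outer_ball hx ((mem_ball_add_iff hν hr.1).2 h)
  · intro y hy
    rw [mem_ball_sub_iff hν hR, ← mul_neg] at hy
    obtain ⟨r, hr, h⟩ := key _ _ (by positivity) hy
    exact hr.inner_ball hx ((mem_ball_sub_iff hν hr.1).2 (by rwa [← mul_neg]))

theorem UniformBall.abs_inner_le {r : ℝ} (h : UniformBall E r) {x y : Space n}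
    (hx : x ∈ frontier E) (hy : y ∈ frontier E) :
    2 * r * |inner ℝ (y - x) (normal E x)| ≤ ‖y - x‖ ^ 2 := by
  have hν := h.norm_normal hx
  have h1 : y ∉ ball (x + r • normal E x) r := fun hb => by
    have := interior_maximal (h.outer_ball hx) isOpen_ball hb
    rw [interior_compl] at this
    exact this hy.1
  have h2 : y ∉ ball (x - r • normal E x) r := fun hb =>
    hy.2 (interior_maximal (h.inner_ball hx) isOpen_ball hb)
  rw [mem_ball_add_iff hν h.1, not_lt] at h1
  rw [mem_ball_sub_iff hν h.1, not_lt] at h2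
  rcases abs_cases (inner ℝ (y - x) (normal E x)) with ⟨e, -⟩ | ⟨e, -⟩ <;> rw [e] <;> linarith

theorem UniformBall.abs_twoPoint_le {r : ℝ} (h : UniformBall E r) {x y : Space n}
    (hx : x ∈ frontier E) (hy : y ∈ frontier E) (hxy : x ≠ y) :
    |twoPoint E x y| ≤ 1 / (2 * r) := by
  have h0 : 0 < ‖x - y‖ ^ 2 := by
    have := norm_pos_iff.2 (sub_ne_zero.2 hxy)
    positivity
  have := h.abs_inner_le hx hy
  have hr := h.1
  rw [twoPoint, abs_div, abs_of_pos h0, div_le_div_iff₀ h0 (by positivity), ← neg_sub y x,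
    inner_neg_left, abs_neg, norm_neg]
  linarith

/-- The outer ball at each of the two points is disjoint from the inner ball at the other. Adding
the squares of the two resulting inequalities cancels the mixed terms, and `‖ν + ν'‖ ^ 2 = 4 - ‖ν -
ν'‖ ^ 2` does the rest. -/
theorem UniformBall.norm_normal_sub_le {r : ℝ} (h : UniformBall E r) {x y : Space n}
    (hx : x ∈ frontier E) (hy : y ∈ frontier E) :
    r * ‖normal E x - normal E y‖ ≤ ‖x - y‖ := by
  have far : ∀ {a b : Space n}, a ∈ frontier E → b ∈ frontier E →
      2 * r ≤ ‖(a - b) + r • (normal E a + normal E b)‖ := by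
    intro a b ha hb
    have := two_mul_le_of_disjoint_ball (disjoint_left.2 fun y hy hy' =>
      h.outer_ball ha hy (h.inner_ball hb hy'))
    refine this.trans_eq (congrArg norm ?_)
    rw [smul_add]; abel
  have hr := h.1
  have h1 := far hx hy
  have h2 := far hy hx
  rw [add_comm (normal E y)] at h2
  have e1 := norm_add_sq_real (x - y) (r • (normal E x + normal E y))
  have e2 := norm_add_sq_real (y - x) (r • (normal E x + normal E y))
  rw [← neg_sub x y, inner_neg_left, norm_neg, neg_sub] at e2
  have e3 : ‖r • (normal E x + normal E y)‖ ^ 2 = r ^ 2 * ‖normal E x + normal E y‖ ^ 2 := by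
    rw [norm_smul, Real.norm_eq_abs, mul_pow, sq_abs]
  have e4 := parallelogram_law_with_norm ℝ (normal E x) (normal E y)
  rw [h.norm_normal hx, h.norm_normal hy] at e4
  rw [e3] at e1 e2
  have s1 := mul_self_le_mul_self (by positivity) h1
  have s2 := mul_self_le_mul_self (by positivity) h2
  rw [← sq_le_sq₀ (by positivity) (norm_nonneg _), mul_pow]
  nlinarith

theorem twoPointValues_nonempty
    (hbdd : Bornology.IsBounded E) (hne : E.Nonempty) (hball : ∃ r : ℝ, UniformBall E r) :
    (twoPointValues E).Nonempty := by
  obtain ⟨r, hr⟩ := hball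
  obtain ⟨x, hx⟩ := frontier_nonempty hbdd hne
  have hν := hr.norm_normal hx
  set q := x - r • normal E x
  have hq : q ∈ E := hr.inner_ball hx (mem_ball_self hr.1)
  obtain ⟨C, hC⟩ := hbdd.subset_closedBall q
  -- The ray from the inner centre pointing away from `x` leaves the bounded set, so it meets the
  -- boundary at a point other than `x`.
  have hout : q - (|C| + 1) • normal E x ∉ E := by
    intro h
    have := hC h
    rw [mem_closedBall, dist_eq_norm, sub_sub_cancel_left, norm_neg, norm_smul, hν, mul_one,
      Real.norm_eq_abs, abs_of_nonneg (by positivity)] at this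
    linarith [le_abs_self C]
  obtain ⟨y, hy, hyE⟩ := exists_mem_segment_frontier hq hout
  refine ⟨_, x, hx, y, hyE, ?_, rfl⟩
  rintro rfl
  obtain ⟨t, ⟨ht, -⟩, h⟩ := (segment_eq_image' ℝ q (q - (|C| + 1) • normal E x)) ▸ hy
  have h' := congrArg (fun v => inner ℝ (v - q) (normal E x)) h
  simp only [add_sub_cancel_left, sub_sub_cancel_left, q, sub_sub_cancel, smul_neg, inner_neg_left,
    real_inner_smul_left, real_inner_self_eq_norm_sq, hν] at h'
  nlinarith [hr.1, mul_nonneg ht (show 0 ≤ |C| + 1 by positivity)]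

theorem isLUB_twoPointNorm
    (hbdd : Bornology.IsBounded E) (hne : E.Nonempty) (hball : ∃ r : ℝ, UniformBall E r) :
    IsLUB (twoPointValues E) (twoPointNorm E) := by
  refine isLUB_csSup (twoPointValues_nonempty hbdd hne hball) ?_
  obtain ⟨r, hr⟩ := hball
  refine ⟨1 / (2 * r), ?_⟩
  rintro _ ⟨x, hx, y, hy, hxy, rfl⟩
  exact hr.abs_twoPoint_le hx hy hxy

theorem two_mul_twoPointNorm
    (hbdd : Bornology.IsBounded E) (hne : E.Nonempty) (hball : ∃ r : ℝ, UniformBall E r) :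
    2 * twoPointNorm E = 1 / maxRadius E := by
  have hU := uniformBall_maxRadius hbdd hne hball
  have hlub := isLUB_twoPointNorm hbdd hne hball
  have hR := hU.1
  have h1 : twoPointNorm E ≤ 1 / (2 * maxRadius E) := by
    refine hlub.2 ?_
    rintro _ ⟨x, hx, y, hy, hxy, rfl⟩
    exact hU.abs_twoPoint_le hx hy hxy
  have h2 : 1 / (2 * maxRadius E) ≤ twoPointNorm E := by
    by_contra! hlt
    have h0 : 0 ≤ twoPointNorm E := by
      obtain ⟨s, hs⟩ := twoPointValues_nonempty hbdd hne hball
      refine le_trans ?_ (hlub.1 hs)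
      obtain ⟨x, -, y, -, -, rfl⟩ := hs
      positivity
    -- Working with `s` strictly above the norm avoids dividing by a norm not yet known to be
    -- positive; the radius `1 / (2 * s)` will be admissible and exceed the maximal one.
    obtain ⟨s, hs, hs'⟩ := exists_between hlt
    have hs0 : 0 < s := h0.trans_lt hs
    have hRr : maxRadius E < 1 / (2 * s) := by
      rw [lt_div_iff₀ (by positivity)] at hs' ⊢
      linarith
    refine hRr.not_ge ((isLUB_maxRadius hbdd hne hball).1 ?_)
    have hr0 : 0 < 1 / (2 * s) := by positivity
    have hbound : ∀ x ∈ frontier E, ∀ y ∈ frontier E,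
        2 * (1 / (2 * s)) * |inner ℝ (y - x) (normal E x)| ≤ ‖y - x‖ ^ 2 := by
      intro x hx y hy
      rcases eq_or_ne x y with rfl | hxy
      · simp
      have h3 : |twoPoint E x y| ≤ s := (hlub.1 ⟨x, hx, y, hy, hxy, rfl⟩).trans hs.le
      have h4 : 0 < ‖y - x‖ ^ 2 := by
        have := norm_pos_iff.2 (sub_ne_zero.2 hxy.symm)
        positivity
      rw [twoPoint, ← neg_sub y x, inner_neg_left, norm_neg, abs_div, abs_neg, abs_of_pos h4,
        div_le_iff₀ h4] at h3
      field_simp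
      linarith
    refine uniformBall_iff.2 ⟨hr0, fun x hx => ⟨hU.isOuterUnitNormal hx, ?_, ?_⟩⟩
    · have hν := hU.norm_normal hx
      have hd : Disjoint (ball (x + (1 / (2 * s)) • normal E x) (1 / (2 * s)))
          (frontier Eᶜ) := by
        rw [frontier_compl]
        refine disjoint_left.2 fun y hy hyE => ?_
        rw [mem_ball_add_iff hν hr0] at hy
        have := hbound x hx y hyE
        nlinarith [le_abs_self (inner ℝ (y - x) (normal E x))]
      have hc : x + maxRadius E • normal E x ∈ ball (x + (1 / (2 * s)) • normal E x)
          (1 / (2 * s)) := by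
        rw [mem_ball, dist_eq_norm, add_sub_add_left_eq_sub, ← sub_smul, norm_smul, hν,
          Real.norm_eq_abs, abs_sub_comm, abs_of_pos (by linarith)]
        linarith
      exact (subset_interior_of_disjoint_frontier (convex_ball _ _).isPreconnected hd hc
        (hU.outer_ball hx (mem_ball_self hR))).trans interior_subset
    · have hν := hU.norm_normal hx
      have hd : Disjoint (ball (x - (1 / (2 * s)) • normal E x) (1 / (2 * s)))
          (frontier E) := by
        refine disjoint_left.2 fun y hy hyE => ?_
        rw [mem_ball_sub_iff hν hr0] at hy
        have := hbound x hx y hyE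
        nlinarith [neg_abs_le (inner ℝ (y - x) (normal E x))]
      have hc : x - maxRadius E • normal E x ∈ ball (x - (1 / (2 * s)) • normal E x)
          (1 / (2 * s)) := by
        rw [mem_ball, dist_eq_norm, sub_sub_sub_cancel_left, ← sub_smul, norm_smul, hν,
          Real.norm_eq_abs, abs_of_pos (by linarith)]
        linarith
      exact (subset_interior_of_disjoint_frontier (convex_ball _ _).isPreconnected hd hc
        (hU.inner_ball hx (mem_ball_self hR))).trans interior_subset
  rw [h1.antisymm h2]
  field_simp

theorem norm_normal_sub_div_le
    (hbdd : Bornology.IsBounded E) (hne : E.Nonempty) (hball : ∃ r : ℝ, UniformBall E r)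
    {x y : Space n} (hx : x ∈ frontier E) (hy : y ∈ frontier E)
    (hxy : x ≠ y) : ‖normal E x - normal E y‖ / ‖x - y‖ ≤ 2 * twoPointNorm E := by
  have hU := uniformBall_maxRadius hbdd hne hball
  rw [two_mul_twoPointNorm hbdd hne hball,
    div_le_div_iff₀ (norm_pos_iff.2 (sub_ne_zero.2 hxy)) hU.1]
  linarith [hU.norm_normal_sub_le hx hy]

end Geometry

/-! ### The signed distance function -/

section Distance

variable {n : ℕ} {E : Set (Space n)}

theorem signedDist_of_mem {x : Space n} (hx : x ∈ E) : signedDist E x = -infDist x Eᶜ :=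
  if_pos hx

theorem signedDist_of_notMem {x : Space n} (hx : x ∉ E) : signedDist E x = infDist x E :=
  if_neg hx

theorem signedDist_compl (x : Space n) : signedDist Eᶜ x = -signedDist E x := by
  by_cases hx : x ∈ E
  · rw [signedDist_of_mem hx, signedDist_of_notMem (not_not.2 hx), neg_neg]
  · rw [signedDist_of_notMem hx, signedDist_of_mem (mem_compl hx), compl_compl]

theorem signedDist_nonpos {x : Space n} (hx : x ∈ E) : signedDist E x ≤ 0 := by
  rw [signedDist_of_mem hx]
  exact neg_nonpos.2 infDist_nonneg

theorem signedDist_nonneg {x : Space n} (hx : x ∉ E) : 0 ≤ signedDist E x := by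
  rw [signedDist_of_notMem hx]
  exact infDist_nonneg

theorem signedDist_of_mem_frontier {x : Space n} (hx : x ∈ frontier E) : signedDist E x = 0 := by
  by_cases h : x ∈ E
  · rw [signedDist_of_mem h, infDist_zero_of_mem_closure, neg_zero]
    exact frontier_subset_closure (frontier_compl E ▸ hx)
  · rw [signedDist_of_notMem h, infDist_zero_of_mem_closure hx.1]

/-- Only pairs on opposite sides need care: the segment between them meets the boundary, and each
distance is at most the length of its piece. -/
theorem lipschitzWith_signedDist (E : Set (Space n)) : LipschitzWith 1 (signedDist E) := by
  have cross : ∀ {x y : Space n}, x ∈ E → y ∉ E → signedDist E y - signedDist E x ≤ dist x y := by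
    intro x y hx hy
    obtain ⟨w, hw, hwE⟩ := exists_mem_segment_frontier hx hy
    rw [signedDist_of_mem hx, signedDist_of_notMem hy, ← dist_add_dist_of_mem_segment hw]
    have h1 : infDist y E ≤ dist w y := by
      rw [← infDist_closure, dist_comm]
      exact infDist_le_dist_of_mem hwE.1
    have h2 : infDist x Eᶜ ≤ dist x w := by
      rw [← infDist_closure]
      exact infDist_le_dist_of_mem (frontier_subset_closure (frontier_compl E ▸ hwE))
    linarith
  refine LipschitzWith.of_le_add fun x y => ?_
  by_cases hx : x ∈ E <;> by_cases hy : y ∈ E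
  · rw [signedDist_of_mem hx, signedDist_of_mem hy]
    have := infDist_le_infDist_add_dist (s := Eᶜ) (x := y) (y := x)
    rw [dist_comm] at this
    linarith
  · linarith [signedDist_nonpos hx, signedDist_nonneg hy, dist_nonneg (x := x) (y := y)]
  · have := cross hy hx
    rw [dist_comm] at this
    linarith
  · rw [signedDist_of_notMem hx, signedDist_of_notMem hy]
    exact infDist_le_infDist_add_dist

theorem le_signedDist_of_ball_subset (hne : E.Nonempty) {p : Space n} {r : ℝ} (hr : 0 < r)
    (h : ball p r ⊆ Eᶜ) : r ≤ signedDist E p := by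
  rw [signedDist_of_notMem (h (mem_ball_self hr)), le_infDist hne]
  intro y hy
  by_contra! hlt
  exact h (mem_ball'.2 hlt) hy

theorem ball_subset_compl_of_le_signedDist {p : Space n} {r : ℝ} (h : r ≤ signedDist E p) :
    ball p r ⊆ Eᶜ := by
  intro y hy hyE
  have := (lipschitzWith_signedDist E).le_add_mul p y
  rw [NNReal.coe_one, one_mul, dist_comm] at this
  linarith [mem_ball.1 hy, signedDist_nonpos hyE]

theorem exists_foot (hne : E.Nonempty) {w : Space n} (hw : 0 < signedDist E w) :
    ∃ y, signedDist E y = 0 ∧ ‖w - y‖ ≤ signedDist E w := by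
  obtain ⟨y, hy, h⟩ := isClosed_closure.exists_infDist_eq_dist hne.closure w
  have hwE : w ∉ E := fun h => hw.not_ge (signedDist_nonpos h)
  rw [infDist_closure, dist_eq_norm, ← signedDist_of_notMem hwE] at h
  refine ⟨y, le_antisymm ?_ ?_, h.ge⟩
  · by_cases hyE : y ∈ E
    · exact signedDist_nonpos hyE
    · rw [signedDist_of_notMem hyE, infDist_zero_of_mem_closure hy]
  · have := (lipschitzWith_signedDist E).le_add_mul w y
    rw [NNReal.coe_one, one_mul, dist_eq_norm] at this
    linarith

end Distance

/-! ### Differentiability of 1-Lipschitz, distance-like functions -/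

section Calculus

variable {n : ℕ}

/-- The difference `h - g` has a minimum at `z`, so both barriers share a derivative there, and the
remainder of `f` is trapped between theirs. -/
theorem differentiableAt_of_squeeze {f g h : Space n → ℝ} {z : Space n}
    (hg : DifferentiableAt ℝ g z) (hh : DifferentiableAt ℝ h z) (hgf : ∀ y, g y ≤ f y)
    (hfh : ∀ y, f y ≤ h y) (hz : g z = h z) : DifferentiableAt ℝ f z := by
  have hmin : IsLocalMin (h - g) z := Eventually.of_forall fun y => by
    simp only [Pi.sub_apply, hz, sub_self, sub_nonneg]
    exact (hgf y).trans (hfh y)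
  have he : fderiv ℝ h z = fderiv ℝ g z := by
    have := hmin.fderiv_eq_zero
    rwa [fderiv_sub hh hg, sub_eq_zero] at this
  have hfz : f z = g z := le_antisymm ((hfh z).trans hz.ge) (hgf z)
  have hg' := hg.hasFDerivAt.isLittleO
  have hh' := hh.hasFDerivAt.isLittleO
  rw [he] at hh'
  refine HasFDerivAt.differentiableAt (f' := fderiv ℝ g z) (.of_isLittleO ?_)
  refine (Asymptotics.IsBigO.of_bound 1 (Eventually.of_forall fun y => ?_)).trans_isLittleO
    (hg'.norm_left.add hh'.norm_left)
  simp only [Real.norm_eq_abs, one_mul]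
  have h1 := hgf y
  have h2 := hfh y
  rw [abs_of_nonneg (add_nonneg (abs_nonneg (g y - g z - _)) (abs_nonneg _)), abs_le]
  constructor
  · linarith [neg_abs_le (g y - g z - fderiv ℝ g z (y - z)),
      abs_nonneg (h y - h z - fderiv ℝ g z (y - z))]
  · linarith [le_abs_self (h y - h z - fderiv ℝ g z (y - z)),
      abs_nonneg (g y - g z - fderiv ℝ g z (y - z))]

variable {d : Space n → ℝ}

theorem eq_sub_of_lipschitz (hd : LipschitzWith 1 d) {z u : Space n} (hu : ‖u‖ = 1) {T s : ℝ}
    (hz : d (z - T • u) = d z - T) (hs : s ∈ Icc 0 T) : d (z - s • u) = d z - s := by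
  have h1 := hd.le_add_mul z (z - s • u)
  have h2 := hd.le_add_mul (z - s • u) (z - T • u)
  rw [NNReal.coe_one, one_mul, dist_eq_norm] at h1 h2
  rw [sub_sub_cancel, norm_smul, hu, mul_one, Real.norm_eq_abs, abs_of_nonneg hs.1] at h1
  rw [sub_sub_sub_cancel_left, ← sub_smul, norm_smul, hu, mul_one, Real.norm_eq_abs,
    abs_of_nonneg (by linarith [hs.2])] at h2
  linarith

/-- If a `1`-Lipschitz function decreases with unit speed along a segment ending at a point of
differentiability, then its gradient there is the direction of the segment. -/
theorem fderiv_apply_of_lipschitz (hd : LipschitzWith 1 d) {z u : Space n} (hu : ‖u‖ = 1) {T : ℝ}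
    (hT : 0 < T) (hz : d (z - T • u) = d z - T) (hdiff : DifferentiableAt ℝ d z) (v : Space n) :
    fderiv ℝ d z v = inner ℝ u v := by
  have h1 : fderiv ℝ d z u = 1 := by
    have hc : HasDerivAt (fun s : ℝ => z - s • u) (-u) 0 := by
      simpa using ((hasDerivAt_id (0 : ℝ)).smul_const u).const_sub z
    have hA : HasDerivAt (fun s : ℝ => d (z - s • u)) (fderiv ℝ d z (-u)) 0 :=
      HasFDerivAt.comp_hasDerivAt_of_eq (f := fun s : ℝ => z - s • u) 0 hdiff.hasFDerivAt hc
        (by simp)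
    have hB : HasDerivWithinAt (fun s : ℝ => d (z - s • u)) (-1) (Icc 0 T) 0 := by
      refine HasDerivWithinAt.congr (f := fun s => d z - s) ?_
        (fun s hs => eq_sub_of_lipschitz hd hu hz hs) (by simp)
      simpa using ((hasDerivAt_id (0 : ℝ)).const_sub (d z)).hasDerivWithinAt
    have := (uniqueDiffOn_Icc hT 0 (left_mem_Icc.2 hT.le)).eq_deriv _ hA.hasDerivWithinAt hB
    rw [map_neg] at this
    linarith
  set w := (InnerProductSpace.toDual ℝ (Space n)).symm (fderiv ℝ d z) with hw
  have hwv : ∀ v, inner ℝ w v = fderiv ℝ d z v := fun v =>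
    InnerProductSpace.toDual_symm_apply
  have hn : ‖w‖ ≤ 1 := by
    rw [hw, LinearIsometryEquiv.norm_map]
    simpa using norm_fderiv_le_of_lipschitz ℝ hd (x₀ := z)
  have : w = (1 : ℝ) • u := eq_smul_of_le_inner hu hn (by rw [hwv, h1])
  rw [← hwv, this, one_smul]

/-- A distance-like function which increases with unit speed along a segment keeps doing so beyond
the end point, as long as it is differentiable in a ball around it. -/
theorem eq_add_of_differentiable (hd : LipschitzWith 1 d)
    (hfoot : ∀ w, 0 < d w → ∃ y, d y = 0 ∧ ‖w - y‖ ≤ d w) {x ν : Space n} (hν : ‖ν‖ = 1)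
    {R h : ℝ} (hh : 0 < h) (hR : 0 < R) (hx : d x = 0) (hz : d (x + R • ν) = R) (hhR : h ≤ R)
    (hdiff : ∀ w ∈ closedBall (x + R • ν) h, DifferentiableAt ℝ d w) :
    d (x + (R + h) • ν) = R + h := by
  set z := x + R • ν with hzdef
  -- The gradient at a maximiser `w` over the ball is the unit vector `u` pointing from its foot `y`
  -- to `w`. Maximality against `z + h • u` forces `w = z + h • u`. At `z` both `u` and `ν` are the
  -- gradient, so `u = ν`.
  obtain ⟨w, hw, hmax⟩ := (isCompact_closedBall z h).exists_isMaxOn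
    ⟨z, mem_closedBall_self hh.le⟩ hd.continuous.continuousOn
  have hzw : R ≤ d w := hz ▸ hmax (mem_closedBall_self hh.le)
  have hT : 0 < d w := hR.trans_le hzw
  obtain ⟨y, hy, hwy⟩ := hfoot w hT
  have hwy' : ‖w - y‖ = d w := by
    refine hwy.antisymm ?_
    have := hd.le_add_mul w y
    rw [NNReal.coe_one, one_mul, dist_eq_norm] at this
    linarith
  obtain ⟨u, hu⟩ : ∃ u, u = (d w)⁻¹ • (w - y) := ⟨_, rfl⟩
  have hu1 : ‖u‖ = 1 := by
    rw [hu, norm_smul, hwy', norm_inv, Real.norm_eq_abs, abs_of_pos hT, inv_mul_cancel₀ hT.ne']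
  have hyu : w - d w • u = y := by
    rw [hu, smul_inv_smul₀ hT.ne', sub_sub_cancel]
  have hwu : d (w - d w • u) = d w - d w := by rw [hyu, hy, sub_self]
  have hgrad := fderiv_apply_of_lipschitz hd hu1 hT hwu (hdiff w hw)
  have hle : fderiv ℝ d w (z + h • u - w) ≤ 0 := by
    refine hmax.localize.hasFDerivWithinAt_nonpos (hdiff w hw).hasFDerivAt.hasFDerivWithinAt
      (sub_mem_posTangentConeAt_of_segment_subset
        ((convex_closedBall z h).segment_subset hw ?_))
    rw [mem_closedBall, dist_eq_norm, add_sub_cancel_left, norm_smul, hu1, mul_one,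
      Real.norm_eq_abs, abs_of_pos hh]
  have hwz : ‖w - z‖ ≤ h := by rw [← dist_eq_norm]; exact hw
  have hpar : w - z = h • u := by
    refine eq_smul_of_le_inner hu1 hwz ?_
    have e : z + h • u - w = h • u - (w - z) := by abel
    rw [hgrad, e, inner_sub_right, real_inner_smul_right, real_inner_self_eq_norm_sq, hu1,
      real_inner_comm] at hle
    linarith
  have hzu : z = w - h • u := by rw [← hpar, sub_sub_cancel]
  have hdz : d z = d w - h := by
    rw [hzu]
    exact eq_sub_of_lipschitz hd hu1 hwu ⟨hh.le, hhR.trans hzw⟩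
  have hdw : d w = R + h := by linarith
  have hfz := hdiff z (mem_closedBall_self hh.le)
  have g1 := fderiv_apply_of_lipschitz hd hu1 (z := z) hR (by
    rw [hzu, sub_sub, ← add_smul, add_comm h, ← hdw, hwu, ← hzu, hz, sub_self, sub_self]) hfz
  have g2 := fderiv_apply_of_lipschitz hd hν (z := z) hR (by
    rw [hz, hzdef, add_sub_cancel_right, hx, sub_self]) hfz
  have huν : u = ν := by
    refine ext_inner_right ℝ fun v => ?_
    rw [← g1, g2]
  have : x + (R + h) • ν = w := by
    rw [add_smul, ← add_assoc, ← hzdef, ← huν, ← hpar, add_sub_cancel]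
  rw [this, hdw]

end Calculus

/-! ### Ball radii versus radii of differentiability -/

section Radii

variable {n : ℕ} {E : Set (Space n)}

theorem isOuterUnitNormal_compl {x ν : Space n} (h : IsOuterUnitNormal E x ν) :
    IsOuterUnitNormal Eᶜ x (-ν) := by
  refine ⟨by rw [norm_neg, h.1], fun ε hε => ?_⟩
  obtain ⟨δ, hδ, H⟩ := h.2 ε hε
  refine ⟨δ, hδ, fun y hy => ⟨fun h1 => ?_, fun h1 => ?_⟩⟩
  · rw [inner_neg_right] at h1
    exact not_not.2 ((H y hy).2 (by linarith))
  · rw [inner_neg_right] at h1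
    exact (H y hy).1 (by linarith)

theorem UniformBall.compl {r : ℝ} (h : UniformBall E r) : UniformBall Eᶜ r := by
  refine ⟨h.1, fun x hx => ?_⟩
  obtain ⟨p, q, hp, hq, hxp, hxq⟩ := h.2 x (frontier_compl E ▸ hx)
  exact ⟨q, p, by rwa [compl_compl], hp, hxq, hxp⟩

theorem UniformBall.normal_compl {r : ℝ} (h : UniformBall E r) {x : Space n}
    (hx : x ∈ frontier E) : normal Eᶜ x = -normal E x :=
  normal_eq (isOuterUnitNormal_compl (h.isOuterUnitNormal hx))

theorem UniformBall.signedDist_outer (hne : E.Nonempty) {r : ℝ} (h : UniformBall E r)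
    {x : Space n} (hx : x ∈ frontier E) : signedDist E (x + r • normal E x) = r := by
  refine le_antisymm ?_ (le_signedDist_of_ball_subset hne h.1 (h.outer_ball hx))
  have := (lipschitzWith_signedDist E).le_add_mul (x + r • normal E x) x
  rwa [signedDist_of_mem_frontier hx, NNReal.coe_one, one_mul, dist_eq_norm,
    add_sub_cancel_left, norm_smul, h.norm_normal hx, mul_one, zero_add, Real.norm_eq_abs,
    abs_of_pos h.1] at this

theorem UniformBall.signedDist_inner (hne : Eᶜ.Nonempty) {r : ℝ} (h : UniformBall E r)
    {x : Space n} (hx : x ∈ frontier E) : signedDist E (x - r • normal E x) = -r := by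
  have := h.compl.signedDist_outer hne (frontier_compl E ▸ hx)
  rw [h.normal_compl hx, signedDist_compl, smul_neg, ← sub_eq_add_neg] at this
  linarith

/-- An exterior point closer than `r` to the boundary lies on the normal line through its nearest
boundary point. -/
theorem UniformBall.exists_eq_add {r : ℝ} (h : UniformBall E r) {z : Space n}
    (hz : z ∈ thickening r (frontier E)) (hzE : z ∉ E) :
    ∃ x ∈ frontier E, ∃ t, |t| < r ∧ z = x + t • normal E x := by
  rw [mem_thickening_iff] at hz
  obtain ⟨x₀, hx₀, hd⟩ := hz
  obtain ⟨x, hx, hxd⟩ := isClosed_frontier.exists_infDist_eq_dist ⟨x₀, hx₀⟩ z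
  have hlt : dist z x < r := hxd ▸ (infDist_le_dist_of_mem hx₀).trans_lt hd
  refine ⟨x, hx, dist z x, by rwa [abs_of_nonneg dist_nonneg], ?_⟩
  have hν := h.norm_normal hx
  -- The segment from the inner centre to `z` crosses the boundary at least `r` from the centre and
  -- at least `dist z x` from `z`. This is equality in the triangle inequality through `x`.
  have hfar : dist z x + r ≤ dist z (x - r • normal E x) := by
    obtain ⟨w, hw, hwE⟩ := exists_mem_segment_frontier
      (h.inner_ball hx (mem_ball_self h.1)) hzE
    have h1 : dist z x ≤ dist z w := hxd ▸ infDist_le_dist_of_mem hwE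
    have h2 : r ≤ dist w (x - r • normal E x) := by
      by_contra! hlt
      exact hwE.2 (interior_maximal (h.inner_ball hx) isOpen_ball (mem_ball.2 hlt))
    have := dist_add_dist_of_mem_segment hw
    rw [dist_comm _ w, dist_comm w z, dist_comm _ z] at this
    linarith
  rw [dist_eq_norm, dist_eq_norm, sub_sub_eq_add_sub, add_sub_right_comm] at hfar
  have hsq := mul_self_le_mul_self (by have := h.1; positivity) hfar
  have e := norm_add_sq_real (z - x) (r • normal E x)
  rw [norm_smul, hν, mul_one, real_inner_smul_right, Real.norm_eq_abs, sq_abs] at e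
  have : z - x = ‖z - x‖ • normal E x := by
    refine eq_smul_of_le_inner hν le_rfl ?_
    have := h.1
    nlinarith
  rw [dist_eq_norm, ← this, add_sub_cancel]

/-- The Lipschitz bound from the two ball centres gives cone-shaped barriers below and above. Both
equal `t` at `x + t • ν`, and `|t| < r` keeps that point away from their apexes. -/
theorem UniformBall.differentiableAt_signedDist (hne : E.Nonempty) (hne' : Eᶜ.Nonempty) {r : ℝ}
    (h : UniformBall E r) {x : Space n} (hx : x ∈ frontier E) {t : ℝ} (ht : |t| < r) :
    DifferentiableAt ℝ (signedDist E) (x + t • normal E x) := by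
  have hν := h.norm_normal hx
  have hν0 : normal E x ≠ 0 := fun h0 => by simp [h0] at hν
  obtain ⟨ht1, ht2⟩ := abs_lt.1 ht
  have e1 : x + t • normal E x - (x + r • normal E x) = (t - r) • normal E x := by
    rw [add_sub_add_left_eq_sub, sub_smul]
  have e2 : x + t • normal E x - (x - r • normal E x) = (t + r) • normal E x := by
    rw [add_smul]; abel
  refine differentiableAt_of_squeeze (g := fun y => r - ‖y - (x + r • normal E x)‖)
    (h := fun y => ‖y - (x - r • normal E x)‖ - r) ?_ ?_ ?_ ?_ ?_
  · refine (differentiableAt_const r).sub ((differentiableAt_id.sub_const _).norm ℝ ?_)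
    simp only [id]
    rw [e1]
    exact smul_ne_zero (by linarith) hν0
  · refine ((differentiableAt_id.sub_const _).norm ℝ ?_).sub_const r
    simp only [id]
    rw [e2]
    exact smul_ne_zero (by linarith) hν0
  · intro y
    have := (lipschitzWith_signedDist E).le_add_mul (x + r • normal E x) y
    rw [h.signedDist_outer hne hx, NNReal.coe_one, one_mul, dist_comm, dist_eq_norm] at this
    linarith
  · intro y
    have := (lipschitzWith_signedDist E).le_add_mul y (x - r • normal E x)
    rw [h.signedDist_inner hne' hx, NNReal.coe_one, one_mul, dist_eq_norm] at this
    linarith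
  · rw [e1, e2, norm_smul, norm_smul, hν, Real.norm_eq_abs, Real.norm_eq_abs,
      abs_of_neg (by linarith), abs_of_pos (by linarith)]
    ring

theorem UniformBall.mem_diffRadii (hne : E.Nonempty) (hne' : Eᶜ.Nonempty) {r : ℝ}
    (h : UniformBall E r) : r ∈ diffRadii E := by
  refine ⟨h.1, fun z hz => DifferentiableAt.differentiableWithinAt ?_⟩
  by_cases hzE : z ∈ E
  · obtain ⟨x, hx, t, ht, rfl⟩ := h.compl.exists_eq_add (frontier_compl E ▸ hz) (not_not.2 hzE)
    rw [frontier_compl] at hx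
    rw [h.normal_compl hx, smul_neg, ← neg_smul]
    exact h.differentiableAt_signedDist hne hne' hx (by rwa [abs_neg])
  · obtain ⟨x, hx, t, ht, rfl⟩ := h.exists_eq_add hz hzE
    exact h.differentiableAt_signedDist hne hne' hx ht

theorem UniformBall.signedDist_outer_add (hne : E.Nonempty) {R r h : ℝ} (hU : UniformBall E R)
    (hr : DifferentiableOn ℝ (signedDist E) (thickening r (frontier E))) (hh : 0 < h)
    (hhR : h ≤ R) (hhr : R + h < r) {x : Space n} (hx : x ∈ frontier E) :
    signedDist E (x + (R + h) • normal E x) = R + h := by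
  have hν := hU.norm_normal hx
  refine eq_add_of_differentiable (lipschitzWith_signedDist E) (fun w hw => exists_foot hne hw) hν
    hh hU.1 (signedDist_of_mem_frontier hx) (hU.signedDist_outer hne hx) hhR fun w hw => ?_
  refine hr.differentiableAt (isOpen_thickening.mem_nhds (mem_thickening_iff.2 ⟨x, hx, ?_⟩))
  have h1 : dist (x + R • normal E x) x = R := by
    rw [dist_eq_norm, add_sub_cancel_left, norm_smul, hν, mul_one, Real.norm_eq_abs,
      abs_of_pos hU.1]
  linarith [dist_triangle w (x + R • normal E x) x, mem_closedBall.1 hw]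

/-- The signed distance keeps growing at unit speed along the normal up to `R + h`, which gives the
larger outer ball; the inner one follows by passing to the complement. -/
theorem UniformBall.add (hne : E.Nonempty) (hne' : Eᶜ.Nonempty) {R r h : ℝ}
    (hU : UniformBall E R) (hr : r ∈ diffRadii E) (hh : 0 < h) (hhR : h ≤ R) (hhr : R + h < r) :
    UniformBall E (R + h) := by
  refine uniformBall_iff.2 ⟨by linarith [hU.1], fun x hx => ⟨hU.isOuterUnitNormal hx, ?_, ?_⟩⟩
  · exact ball_subset_compl_of_le_signedDist
      (hU.signedDist_outer_add hne hr.2 hh hhR hhr hx).ge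
  · have hr' : DifferentiableOn ℝ (signedDist Eᶜ) (thickening r (frontier Eᶜ)) := by
      rw [frontier_compl, show signedDist Eᶜ = fun x => -signedDist E x from
        funext signedDist_compl]
      exact hr.2.neg
    have := ball_subset_compl_of_le_signedDist
      (hU.compl.signedDist_outer_add hne' hr' hh hhR hhr (frontier_compl E ▸ hx)).ge
    rwa [compl_compl, hU.normal_compl hx, smul_neg, ← sub_eq_add_neg] at this

theorem isLUB_diffRadii
    (hbdd : Bornology.IsBounded E) (hne : E.Nonempty) (hball : ∃ r : ℝ, UniformBall E r) :
    IsLUB (diffRadii E) (maxRadius E) := by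
  have hU := uniformBall_maxRadius hbdd hne hball
  have hne' : Eᶜ.Nonempty := by
    rw [nonempty_compl]
    rintro rfl
    exact NormedSpace.unbounded_univ ℝ (Space n) hbdd
  refine IsGreatest.isLUB ⟨hU.mem_diffRadii hne hne', fun r hr => ?_⟩
  by_contra! hlt
  have h0 : 0 < min (maxRadius E) ((r - maxRadius E) / 2) :=
    lt_min hU.1 (by linarith)
  have := (isLUB_maxRadius hbdd hne hball).1 (hU.add hne hne' hr h0 (min_le_left _ _)
    (by linarith [min_le_right (maxRadius E) ((r - maxRadius E) / 2)]))
  linarith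

end Radii

/-! ### Curvature of `C^2`-regular sets -/

section Regular

variable {n : ℕ} {E : Set (Space n)}

theorem IsOuterUnitNormal.mem_frontier {x ν : Space n} (h : IsOuterUnitNormal E x ν) :
    x ∈ frontier E := by
  obtain ⟨δ, hδ, H⟩ := h.2 (1 / 2) (by norm_num)
  have hsmall : ∀ᶠ s in 𝓝[>] (0 : ℝ), 0 < s ∧ s < δ :=
    (eventually_mem_nhdsWithin).and (nhdsWithin_le_nhds (eventually_lt_nhds hδ))
  rw [frontier_eq_closure_inter_closure]
  constructor
  · have hc : Tendsto (fun s : ℝ => x - s • ν) (𝓝[>] 0) (𝓝 x) := by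
      have : Continuous fun s : ℝ => x - s • ν := by fun_prop
      exact (by simpa using this.tendsto 0 : Tendsto _ _ (𝓝 x)).mono_left nhdsWithin_le_nhds
    refine mem_closure_of_tendsto hc (hsmall.mono fun s hs => ?_)
    have e : ‖x - s • ν - x‖ = s := by
      rw [sub_sub_cancel_left, norm_neg, norm_smul, h.1, Real.norm_eq_abs, abs_of_pos hs.1, mul_one]
    refine (H _ (e.trans_lt hs.2)).2 ?_
    rw [e, sub_sub_cancel_left, inner_neg_left, real_inner_smul_left, real_inner_self_eq_norm_sq,
      h.1]
    linarith [hs.1]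
  · have hc : Tendsto (fun s : ℝ => x + s • ν) (𝓝[>] 0) (𝓝 x) := by
      have : Continuous fun s : ℝ => x + s • ν := by fun_prop
      exact (by simpa using this.tendsto 0 : Tendsto _ _ (𝓝 x)).mono_left nhdsWithin_le_nhds
    refine mem_closure_of_tendsto hc (hsmall.mono fun s hs => ?_)
    have e : ‖x + s • ν - x‖ = s := by
      rw [add_sub_cancel_left, norm_smul, h.1, Real.norm_eq_abs, abs_of_pos hs.1, mul_one]
    refine (H _ (e.trans_lt hs.2)).1 ?_
    rw [e, add_sub_cancel_left, real_inner_smul_left, real_inner_self_eq_norm_sq, h.1]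
    linarith [hs.1]

theorem isOuterUnitNormal_of_gradient {g : Space n → ℝ} {y : Space n}
    (hg : DifferentiableAt ℝ g y) (hy : g y = 0) (hne : gradient g y ≠ 0)
    (hloc : ∀ᶠ z in 𝓝 y, (g z < 0 → z ∈ E) ∧ (0 < g z → z ∉ E)) :
    IsOuterUnitNormal E y (‖gradient g y‖⁻¹ • gradient g y) := by
  have hpos : 0 < ‖gradient g y‖ := norm_pos_iff.2 hne
  refine ⟨by rw [norm_smul, norm_inv, norm_norm, inv_mul_cancel₀ hpos.ne'], fun ε hε => ?_⟩
  have ho := hg.hasFDerivAt.isLittleO.def (show 0 < ε * ‖gradient g y‖ by positivity)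
  obtain ⟨δ, hδ, H⟩ := Metric.eventually_nhds_iff.1 (hloc.and ho)
  refine ⟨δ, hδ, fun z hz => ?_⟩
  obtain ⟨⟨hE, hE'⟩, hb⟩ := H (by rwa [dist_eq_norm])
  have hin : fderiv ℝ g y (z - y) = inner ℝ (z - y) (gradient g y) := by
    rw [real_inner_comm, gradient, InnerProductSpace.toDual_symm_apply]
  rw [hy, sub_zero, hin, Real.norm_eq_abs, abs_le] at hb
  rw [real_inner_smul_right, inv_mul_eq_div, lt_div_iff₀ hpos, div_lt_iff₀ hpos]
  exact ⟨fun h => hE' (by linarith), fun h => hE (by linarith)⟩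

/-- Regularity speaks only of `interior E`; this fact excludes boundary points of `E` strictly above
the graph. -/
theorem UniformBall.mem_closure_interior {r : ℝ} (h : UniformBall E r) {x : Space n}
    (hx : x ∈ frontier E) : x ∈ closure (interior E) := by
  obtain ⟨-, q, -, hq, -, hxq⟩ := h.2 x hx
  have := closure_mono (interior_maximal hq isOpen_ball)
  rw [closure_ball _ h.1.ne'] at this
  exact this (sphere_subset_closedBall hxq)

/-- A regular set is locally the sublevel set of a regular function, and tangent vectors of its
boundary are velocities of curves in the boundary. -/
theorem UniformBall.exists_defining_function {r : ℝ} (h : UniformBall E r) (hreg : IsRegular 2 E)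
    {x : Space n} (hx : x ∈ frontier E) :
    ∃ g : Space n → ℝ, ContDiffAt ℝ 2 g x ∧ gradient g x ≠ 0 ∧
      (∀ᶠ y in 𝓝 x, (g y < 0 → y ∈ E) ∧ (0 < g y → y ∉ E) ∧ (y ∈ frontier E → g y = 0)) ∧
      ∀ τ, inner ℝ (gradient g x) τ = 0 →
        ∃ c : ℝ → Space n, c 0 = x ∧ HasDerivAt c τ 0 ∧ ∀ s, g (c s) = 0 := by
  obtain ⟨Φ, ρ, hρ, R, hR, f, hf, hfR, H⟩ := hreg x hx
  set L₁ : Space n →L[ℝ] EuclideanSpace ℝ (Fin n) :=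
    (WithLp.fstL 2 ℝ (EuclideanSpace ℝ (Fin n)) ℝ).comp
      (Φ.toContinuousLinearEquiv : Space n →L[ℝ] _)
  set L₂ : Space n →L[ℝ] ℝ := (WithLp.sndL 2 ℝ (EuclideanSpace ℝ (Fin n)) ℝ).comp
      (Φ.toContinuousLinearEquiv : Space n →L[ℝ] _)
  have e₁ : ∀ v, (Φ v).fst = L₁ v := fun v => rfl
  have e₂ : ∀ v, (Φ v).snd = L₂ v := fun v => rfl
  simp only [e₁, e₂] at H
  set g : Space n → ℝ := fun y => L₂ (y - x) - f (L₁ (y - x)) with hgdef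
  set C : Set (Space n) := {y | ‖L₁ (y - x)‖ < ρ ∧ |L₂ (y - x)| < R} with hC
  have hCo : IsOpen C :=
    (isOpen_lt (f := fun y => ‖L₁ (y - x)‖) (by fun_prop) continuous_const).inter
      (isOpen_lt (f := fun y => |L₂ (y - x)|) (by fun_prop) continuous_const)
  have hxC : x ∈ C := by simp [hC, hρ, hR]
  have hfat : ∀ u ∈ ball (0 : EuclideanSpace ℝ (Fin n)) ρ, ContDiffAt ℝ 2 f u := fun u hu => by
    exact_mod_cast hf.contDiffAt (isOpen_ball.mem_nhds hu)
  have hgC : ∀ y ∈ C, ContDiffAt ℝ 2 g y := by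
    intro y hy
    have hl : ContDiffAt ℝ 2 (fun y => L₁ (y - x)) y :=
      (L₁.contDiff.comp (contDiff_id.sub contDiff_const)).contDiffAt
    have hl' : ContDiffAt ℝ 2 (fun y => L₂ (y - x)) y :=
      (L₂.contDiff.comp (contDiff_id.sub contDiff_const)).contDiffAt
    exact hl'.sub (ContDiffAt.comp y (hfat _ (mem_ball_zero_iff.2 hy.1)) hl)
  have hint : ∀ y ∈ C, (y ∈ interior E ↔ g y < 0) := fun y hy => by
    rw [H y hy.1 hy.2, sub_neg]
  have hfr : ∀ y ∈ C, y ∈ frontier E → g y = 0 := by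
    intro y hy hyE
    have h1 : ¬ g y < 0 := fun h1 => hyE.2 ((hint y hy).2 h1)
    refine le_antisymm (not_lt.1 fun h2 => ?_) (not_lt.1 h1)
    have hev : ∀ᶠ z in 𝓝 y, z ∈ C ∧ 0 < g z :=
      Filter.Eventually.and (hCo.mem_nhds hy) ((hgC y hy).continuousAt.eventually (eventually_gt_nhds h2))
    obtain ⟨z, ⟨hzC, hz⟩, hzE⟩ := mem_closure_iff_nhds.1 (h.mem_closure_interior hyE) _ hev
    exact hz.not_gt ((hint z hzC).1 hzE)
  have hx0 : f 0 = 0 := by simpa [hgdef] using hfr x hxC hx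
  have hfd : HasFDerivAt f (fderiv ℝ f 0) 0 :=
    ((hfat 0 (mem_ball_self hρ)).differentiableAt (by norm_num)).hasFDerivAt
  have hgd : ∀ v, fderiv ℝ g x v = L₂ v - fderiv ℝ f 0 (L₁ v) := by
    have h1 : HasFDerivAt (fun y => L₁ (y - x)) L₁ x :=
      L₁.hasFDerivAt.comp x ((hasFDerivAt_id x).sub_const x)
    have h2 : HasFDerivAt (fun y => L₂ (y - x)) L₂ x :=
      L₂.hasFDerivAt.comp x ((hasFDerivAt_id x).sub_const x)
    have h3 : HasFDerivAt (fun y => f (L₁ (y - x))) ((fderiv ℝ f 0).comp L₁) x :=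
      HasFDerivAt.comp x (by simpa using hfd) h1
    intro v
    have h4 : HasFDerivAt g (L₂ - (fderiv ℝ f 0).comp L₁) x := h2.sub h3
    rw [h4.fderiv]
    rfl
  have hgr : ∀ v, inner ℝ (gradient g x) v = L₂ v - fderiv ℝ f 0 (L₁ v) := fun v => by
    rw [← hgd, gradient, InnerProductSpace.toDual_symm_apply]
  have s₁ : ∀ p : EuclideanSpace ℝ (Fin n) × ℝ, L₁ (Φ.symm (WithLp.toLp 2 p)) = p.1 := fun p => by
    rw [← e₁, Φ.apply_symm_apply, WithLp.toLp_fst]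
  have s₂ : ∀ p : EuclideanSpace ℝ (Fin n) × ℝ, L₂ (Φ.symm (WithLp.toLp 2 p)) = p.2 := fun p => by
    rw [← e₂, Φ.apply_symm_apply, WithLp.toLp_snd]
  refine ⟨g, hgC x hxC, fun h0 => ?_, ?_, fun τ hτ => ?_⟩
  · have := hgr (Φ.symm (WithLp.toLp 2 (0, 1)))
    rw [h0, s₁, s₂] at this
    simp at this
  · filter_upwards [hCo.mem_nhds hxC] with y hy
    exact ⟨fun hlt => interior_subset ((hint y hy).2 hlt), fun hgt hyE => hgt.ne'
      (hfr y hy ⟨subset_closure hyE, fun hi => hgt.not_gt ((hint y hy).1 hi)⟩), hfr y hy⟩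
  · rw [hgr, sub_eq_zero] at hτ
    -- The line in direction `L₁ τ` is lifted to the graph; its vertical velocity is `L₂ τ` exactly
    -- because `τ` is orthogonal to the gradient.
    refine ⟨fun s => x + Φ.symm (WithLp.toLp 2 (s • L₁ τ, f (s • L₁ τ))), ?_, ?_, fun s => ?_⟩
    · simp [hx0]
    · have h1 : HasDerivAt (fun s : ℝ => s • L₁ τ) (L₁ τ) 0 := by
        simpa using (hasDerivAt_id (0 : ℝ)).smul_const (L₁ τ)
      have h2 : HasDerivAt (fun s : ℝ => f (s • L₁ τ)) (L₂ τ) 0 := by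
        rw [hτ]
        exact HasFDerivAt.comp_hasDerivAt_of_eq (f := fun s : ℝ => s • L₁ τ) 0 hfd h1 (by simp)
      set M : EuclideanSpace ℝ (Fin n) × ℝ →L[ℝ] Space n :=
        (Φ.symm.toContinuousLinearEquiv : _ →L[ℝ] Space n).comp
          ((WithLp.prodContinuousLinearEquiv 2 ℝ (EuclideanSpace ℝ (Fin n)) ℝ).symm :
            _ →L[ℝ] WithLp 2 (EuclideanSpace ℝ (Fin n) × ℝ))
      have h3 := (M.hasFDerivAt.comp_hasDerivAt (0 : ℝ) (h1.prodMk h2)).const_add x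
      have hM : M (L₁ τ, L₂ τ) = τ := Φ.symm_apply_apply τ
      rw [hM] at h3
      exact h3
    · simp only [hgdef, add_sub_cancel_left, s₁, s₂, sub_self]

theorem UniformBall.differentiableWithinAt_normal {r : ℝ} (h : UniformBall E r)
    (hreg : IsRegular 2 E) {x : Space n} (hx : x ∈ frontier E) :
    DifferentiableWithinAt ℝ (normal E) (frontier E) x ∧
      ∀ τ, inner ℝ (normal E x) τ = 0 →
        r * ‖fderivWithin ℝ (normal E) (frontier E) x τ‖ ≤ ‖τ‖ := by
  obtain ⟨g, hg, hg0, hloc, hcurve⟩ := h.exists_defining_function hreg hx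
  have hfd : DifferentiableAt ℝ (fderiv ℝ g) x :=
    (hg.fderiv_right (m := 1) (by norm_num)).differentiableAt (by norm_num)
  have hgrad : DifferentiableAt ℝ (gradient g) x :=
    (InnerProductSpace.toDual ℝ (Space n)).symm.toContinuousLinearEquiv.differentiableAt.comp x hfd
  have hN : DifferentiableAt ℝ (fun y => ‖gradient g y‖⁻¹ • gradient g y) x :=
    ((hgrad.norm ℝ hg0).inv (norm_ne_zero_iff.2 hg0)).smul hgrad
  have hout : ∀ᶠ y in 𝓝 x, g y = 0 →
      IsOuterUnitNormal E y (‖gradient g y‖⁻¹ • gradient g y) := by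
    filter_upwards [hloc.eventually_nhds, hg.eventually (by simp),
      hgrad.continuousAt.eventually_ne hg0] with y h1 h2 h3 h4
    exact isOuterUnitNormal_of_gradient (h2.differentiableAt (by norm_num)) h4 h3
      (h1.mono fun z hz => ⟨hz.1, hz.2.1⟩)
  have hxg : g x = 0 := hloc.self_of_nhds.2.2 hx
  have hnx : normal E x = ‖gradient g x‖⁻¹ • gradient g x :=
    normal_eq (hout.self_of_nhds hxg)
  have hdiff : DifferentiableWithinAt ℝ (normal E) (frontier E) x := by
    refine hN.differentiableWithinAt.congr_of_eventuallyEq ?_ hnx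
    filter_upwards [nhdsWithin_le_nhds hloc, nhdsWithin_le_nhds hout, self_mem_nhdsWithin]
      with y h1 h2 h3
    exact normal_eq (h2 (h1.2.2 h3))
  refine ⟨hdiff, fun τ hτ => ?_⟩
  have hτ' : inner ℝ (gradient g x) τ = 0 := by
    rw [hnx, real_inner_smul_left] at hτ
    exact (mul_eq_zero.1 hτ).resolve_left (inv_ne_zero (norm_ne_zero_iff.2 hg0))
  obtain ⟨c, hc0, hc, hgc⟩ := hcurve τ hτ'
  have hcE : ∀ᶠ s in 𝓝 (0 : ℝ), c s ∈ frontier E := by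
    have : Tendsto c (𝓝 0) (𝓝 x) := hc0 ▸ hc.continuousAt
    exact (this.eventually hout).mono fun s hs => (hs (hgc s)).mem_frontier
  -- The chain rule along `c` identifies the value at a tangent `τ` whichever derivative
  -- `fderivWithin` selects, so the Lipschitz bound for difference quotients passes to the limit.
  have hνc : HasDerivAt (fun s => normal E (c s))
      (fderivWithin ℝ (normal E) (frontier E) x τ) 0 :=
    (HasFDerivWithinAt.comp_hasDerivWithinAt_of_eq (t := frontier E) (f := c) 0
      hdiff.hasFDerivWithinAt (hc.hasDerivWithinAt (s := {s | c s ∈ frontier E}))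
      (fun s hs => hs) hc0.symm).hasDerivAt hcE
  have t1 := (hνc.tendsto_slope_zero.norm).const_mul r
  have t2 := hc.tendsto_slope_zero.norm
  refine le_of_tendsto_of_tendsto t1 t2 (nhdsWithin_le_nhds ?_)
  filter_upwards [hcE] with s hs
  simp only [zero_add, norm_smul, hc0]
  rw [mul_left_comm]
  gcongr
  exact h.norm_normal_sub_le hs hx

/-- In an orthonormal basis starting with the normal, `B_E` kills the first vector and maps the
other `n` to vectors of length at most `1 / r`. -/
theorem UniformBall.curvature_bounds {r : ℝ} (h : UniformBall E r) (hreg : IsRegular 2 E)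
    {x : Space n} (hx : x ∈ frontier E) :
    |meanCurv E x| ≤ n * (1 / r) ∧ frobenius (secondForm E x) ≤ n * (1 / r) := by
  have hr := h.1
  have hν := h.norm_normal hx
  obtain ⟨b, hb⟩ := Orthonormal.exists_orthonormalBasis_extension_of_card_eq (𝕜 := ℝ)
    (E := Space n) (ι := Fin (n + 1)) (by simp) (v := fun _ => normal E x) (s := {0})
    ⟨fun i => hν, fun i j hij => absurd (Subsingleton.elim i j) hij⟩
  have hb0 : b 0 = normal E x := hb 0 rfl
  have hB0 : secondForm E x (b 0) = 0 := by
    simp [secondForm, tangentProj, hb0, hν]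
  have hB : ∀ i : Fin n, ‖secondForm E x (b i.succ)‖ ≤ 1 / r := by
    intro i
    have h0 : inner ℝ (normal E x) (b i.succ) = 0 := by
      rw [← hb0]
      exact b.orthonormal.2 (Fin.succ_ne_zero i).symm
    have := (h.differentiableWithinAt_normal hreg hx).2 _ h0
    rw [b.orthonormal.1] at this
    have e : secondForm E x (b i.succ) =
        fderivWithin ℝ (normal E) (frontier E) x (b i.succ) := by
      simp [secondForm, tangentProj, h0]
    rw [e, le_div_iff₀ hr]
    linarith
  constructor
  · rw [meanCurv, LinearMap.trace_eq_sum_inner _ b, Fin.sum_univ_succ]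
    simp only [ContinuousLinearMap.coe_coe, hB0, inner_zero_right, zero_add]
    refine (Finset.abs_sum_le_sum_abs _ _).trans
      ((Finset.sum_le_card_nsmul _ _ (1 / r) fun i _ => ?_).trans_eq (by simp))
    refine (abs_real_inner_le_norm _ _).trans ?_
    rw [b.orthonormal.1, one_mul]
    exact hB i
  · rw [frobenius, LinearMap.trace_eq_sum_inner _ b, Fin.sum_univ_succ]
    simp only [ContinuousLinearMap.coe_coe, ContinuousLinearMap.comp_apply,
      ContinuousLinearMap.adjoint_inner_right, hB0, inner_zero_right, zero_add,
      real_inner_self_eq_norm_sq]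
    refine Real.sqrt_le_iff.2 ⟨by positivity, ?_⟩
    refine (Finset.sum_le_card_nsmul _ _ ((1 / r) ^ 2) fun i _ =>
      pow_le_pow_left₀ (norm_nonneg _) (hB i) 2).trans ?_
    rw [Finset.card_univ, Fintype.card_fin, nsmul_eq_mul, mul_pow]
    gcongr
    -- The columns give the sharper factor `√n`; it is relaxed to `n` through `n ≤ n ^ 2`.
    exact_mod_cast Nat.le_self_pow two_ne_zero n

end Regular

end BallCond

end

theorem lemma4 (n : ℕ) (E : Set (BallCond.Space n)) (hbdd : Bornology.IsBounded E)
    (hne : E.Nonempty) (hball : ∃ r : ℝ, BallCond.UniformBall E r) :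
    -- the normal field, the radius and the supremum norm are well defined
    (∀ x ∈ frontier E, BallCond.IsOuterUnitNormal E x (BallCond.normal E x)) ∧
    IsLUB {r : ℝ | BallCond.UniformBall E r} (BallCond.maxRadius E) ∧
    IsLUB (BallCond.diffRadii E) (BallCond.maxRadius E) ∧
    IsLUB (BallCond.twoPointValues E) (BallCond.twoPointNorm E) ∧
    -- the identity and the Lipschitz estimate for the normal
    2 * BallCond.twoPointNorm E = 1 / BallCond.maxRadius E ∧
    (∀ x ∈ frontier E, ∀ y ∈ frontier E, x ≠ y →
      ‖BallCond.normal E x - BallCond.normal E y‖ / ‖x - y‖ ≤ 2 * BallCond.twoPointNorm E) ∧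
    -- the curvature bounds for sets of class C^2
    (BallCond.IsRegular 2 E → ∀ x ∈ frontier E,
      DifferentiableWithinAt ℝ (BallCond.normal E) (frontier E) x ∧
      |BallCond.meanCurv E x| ≤ 2 * n * BallCond.twoPointNorm E ∧
      BallCond.frobenius (BallCond.secondForm E x) ≤ 2 * n * BallCond.twoPointNorm E) := by
  have hU := BallCond.uniformBall_maxRadius hbdd hne hball
  have hS := BallCond.two_mul_twoPointNorm hbdd hne hball
  refine ⟨fun x hx => hU.isOuterUnitNormal hx, BallCond.isLUB_maxRadius hbdd hne hball,
    BallCond.isLUB_diffRadii hbdd hne hball, BallCond.isLUB_twoPointNorm hbdd hne hball, hS,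
    fun x hx y hy hxy => BallCond.norm_normal_sub_div_le hbdd hne hball hx hy hxy,
    fun hreg x hx => ?_⟩
  -- The curvature bounds hold for every admissible radius and are used at the largest one.
  have e : 2 * (n : ℝ) * BallCond.twoPointNorm E = n * (1 / BallCond.maxRadius E) := by
    rw [← hS]; ring
  rw [e]
  exact ⟨(hU.differentiableWithinAt_normal hreg hx).1, hU.curvature_bounds hreg hx⟩
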